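/- Let $G=(V,E)$ be a finite simple graph. For each $v\in V$ let $d_v\ge 1$ be an integer; for $A\subseteq V$ put $\mathcal R_A=\prod_{v\in A}[d_v]$, $d_A=|\mathcal R_A|$ and $\mathcal R=\mathcal R_V$, and write $i_A\in\mathcal R_A$ for the restriction of $i\in\mathcal R$. Let $\mathbb C[p]=\mathbb C[p_i: i\in\mathcal R]$. The (complex, non-normalized) graphical model of $G$ is the set $X_G\subseteq\mathbb C^{\mathcal R}$ of all points $p$ of the form $p_i=\prod_{C}\theta^{(C)}_{i_C}$ $(i\in\mathcal R)$, where $C$ runs over the maximal cliques of $G$ and the $\theta^{(C)}_{i_C}$ are arbitrary complex numbers. For a subset $X$ of a complex affine space and $r\ge 1$, let $\mathrm{Sec}^r(X)$ be the Zariski closure of $\{\alpha_1v^1+\dots+\alpha_rv^r:\ \alpha_l\in\mathbb C,\ \alpha_1+\dots+\alpha_r=1,\ v^1,\dots,v^r\in X\}$. Let $I_G^{(r)}\subseteq\mathbb C[p]$ be the vanishing ideal of $\mathrm{Sec}^r(\overline{X_G})$, where the bar denotes Zariski closure. Assume that $G$ is a clique star: there are $k\ge 1$ distinct maximal cliques $\widetilde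 C_1,\dots,\widetilde C_k$ of $G$ such that every vertex and every edge of $G$ lies in some $\widetilde C_l$, and a clique $S$ of $G$ with $\widetilde C_l\cap\widetilde C_m=S$ for all $l\ne m$. Put $C_l=\widetilde C_l\setminus S$, so that $V$ is the disjoint union $C_1\cup\dots\cup C_k\cup S$. Let $Y$ be the complex independence (Segre) model of format $d_{C_1}\times\dots\times d_{C_k}$, that is, the set of all tensors $q\in\mathbb C^{\mathcal R_{C_1}\times\dots\times\mathcal R_{C_k}}$ with $q_{x_1\dots x_k}=\prod_{l=1}^k\theta^{(l)}_{x_l}$, the $\theta^{(l)}_{x_l}$ being arbitrary complex numbers. For $j_S\in\mathcal R_S$, let $I^{(r)}_{j_S,\,d_{C_1}\times\dots\times d_{C_k}}\subseteq\mathbb C[p]$ be the ideal generated by the polynomials obtained from those in the vanishing ideal of $\mathrm{Sec}^r(\overline{Y})$ by replacing each variable $q_{x_1\dots x_k}$ by the variable $p_i$ with $i_S=j_S$ and $i_{C_l}=x_l$ for $l=1,\dots,k$. Then, for every $r\ge 1$, $$I_G^{(r)}=\sum_{j_S\in\mathcal R_S} I^{(r)}_{j_S,\,d_{C_1}\times\dots\times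 d_{C_k}}.$$ Moreover, the summands are in disjoint sets of variables: the ideal with index $j_S$ is generated by polynomials in the variables $p_i$ with $i_S=j_S$, and these sets of variables are disjoint for different $j_S$. -/

import Mathlib

open MvPolynomial

noncomputable section

namespace CliqueStars

/-! ## Secant varieties in complex affine space -/

/-- The Zariski closure of a subset of the affine space `ℂ^σ`. -/
def zariskiClosure {σ : Type*} (X : Set (σ → ℂ)) : Set (σ → ℂ) :=
  zeroLocus ℂ (vanishingIdeal ℂ X)

/-- The `r`-th secant variety of `X`: the Zariski closure of the union of all affine spans of `r`
points of `X`. -/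
def secantVariety {σ : Type*} (r : ℕ) (X : Set (σ → ℂ)) : Set (σ → ℂ) :=
  zariskiClosure
    {p | ∃ (α : Fin r → ℂ) (v : Fin r → σ → ℂ),
      ∑ l, α l = 1 ∧ (∀ l, v l ∈ X) ∧ p = ∑ l, α l • v l}

/-- The vanishing ideal of the `r`-th secant variety of the Zariski closure of `X`. -/
def secantIdeal {σ : Type*} (r : ℕ) (X : Set (σ → ℂ)) : Ideal (MvPolynomial σ ℂ) :=
  vanishingIdeal ℂ (secantVariety r (zariskiClosure X))

/-! ## Undirected graphical models -/

/-- The joint states of the random variables indexed by the vertices in `A`,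
where the variable at `v` has `d v` states. -/
abbrev SubState {V : Type*} (d : V → ℕ) (A : Finset V) : Type _ := ∀ v : A, Fin (d v)

/-- The joint states of all the random variables. -/
abbrev State {V : Type*} (d : V → ℕ) : Type _ := ∀ v : V, Fin (d v)

/-- `C` is a clique of `G` that is maximal under inclusion among all the cliques of `G`. -/
def IsMaxClique {V : Type*} (G : SimpleGraph V) (C : Finset V) : Prop :=
  Maximal (fun s : Finset V => G.IsClique (s : Set V)) C

/-- The type of maximal cliques of `G`. -/
abbrev MaxClique {V : Type*} (G : SimpleGraph V) : Type _ := {C : Finset V // IsMaxClique G C}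

instance {V : Type*} [Fintype V] (G : SimpleGraph V) : Fintype (MaxClique G) :=
  Fintype.ofFinite _

/-- The monomial parametrization `p_i = ∏_C θ^(C)_{i_C}` of the graphical model of `G`,
the product being over the maximal cliques of `G`. -/
def graphParam {V : Type*} [Fintype V] (G : SimpleGraph V) (d : V → ℕ)
    (θ : ∀ C : MaxClique G, SubState d C.1 → ℂ) : State d → ℂ :=
  fun i => ∏ C : MaxClique G, θ C (C.1.restrict i)

/-- The complex graphical model of `G` (not normalized to total mass one): the image of the
monomial parametrization, on all complex parameters. -/
def graphModel {V : Type*} [Fintype V] (G : SimpleGraph V) (d : V → ℕ) : Set (State d → ℂ) :=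
  Set.range (graphParam G d)

/-- The complex independence model (not normalized to total mass one) of `k` random variables with
state spaces `R 0, …, R (k - 1)`: the tensors of format `R 0 × ⋯ × R (k - 1)` of the form
`p_{x_0 … x_{k-1}} = ∏_l θ^(l)_{x_l}`, that is the affine cone over the Segre variety. -/
def independenceModel {k : ℕ} (R : Fin k → Type*) : Set ((∀ l, R l) → ℂ) :=
  Set.range fun (θ : ∀ l, R l → ℂ) (x : ∀ l, R l) => ∏ l, θ l (x l)

/-! ## Clique stars -/

/-- `G` is a clique star with maximal cliques `K 0, …, K (k - 1)` and centre `S`: it is the union,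
on vertices and on edges, of the distinct maximal cliques `K l`, any two of which meet exactly in
the clique `S`. -/
structure IsCliqueStar {V : Type*} [DecidableEq V] (G : SimpleGraph V) {k : ℕ}
    (K : Fin k → Finset V) (S : Finset V) : Prop where
  pos : 0 < k
  injective : Function.Injective K
  isMaxClique : ∀ l, IsMaxClique G (K l)
  cover_vertex : ∀ v, ∃ l, v ∈ K l
  cover_edge : ∀ v w, G.Adj v w → ∃ l, v ∈ K l ∧ w ∈ K l
  isClique_center : G.IsClique (S : Set V)
  inter_eq : ∀ l m, l ≠ m → K l ∩ K m = S

/-- The states of all variables whose restriction to `S` is `j`; these are the indices of the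
unknowns `p_i` with `i_S = j`. -/
def block {V : Type*} (d : V → ℕ) (S : Finset V) (j : SubState d S) : Set (State d) :=
  {i | S.restrict i = j}

/-- A state with `i_S = j` is split into its components on the sets `C_l = K l \ S`. -/
def splitBlock {V : Type*} [DecidableEq V] (d : V → ℕ) {k : ℕ} (K : Fin k → Finset V)
    (S : Finset V) (j : SubState d S) (i : block d S j) (l : Fin k) : SubState d (K l \ S) :=
  (K l \ S).restrict i.1

/-- In a clique star the vertex set is the disjoint union of `S` and of the sets `K l \ S`, so a
state with prescribed `S`-part amounts to a family of states of the sets `K l \ S`. -/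
theorem splitBlock_bijective {V : Type*} [DecidableEq V] {G : SimpleGraph V} {k : ℕ}
    {K : Fin k → Finset V} {S : Finset V} (h : IsCliqueStar G K S) (d : V → ℕ)
    (j : SubState d S) : Function.Bijective (splitBlock d K S j) := by
  constructor
  · rintro ⟨i, hi⟩ ⟨i', hi'⟩ heq
    apply Subtype.ext
    funext v
    by_cases hv : v ∈ S
    · exact congrFun (hi.trans hi'.symm) ⟨v, hv⟩
    · obtain ⟨l, hl⟩ := h.cover_vertex v
      exact congrFun (congrFun heq l) ⟨v, Finset.mem_sdiff.2 ⟨hl, hv⟩⟩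
  · intro t
    choose c hc using h.cover_vertex
    refine ⟨⟨fun v => if hv : v ∈ S then j ⟨v, hv⟩
      else t (c v) ⟨v, Finset.mem_sdiff.2 ⟨hc v, hv⟩⟩, ?_⟩, ?_⟩
    · funext v
      simp [Finset.restrict]
    · funext l v
      obtain ⟨v, hv⟩ := v
      obtain ⟨hvl, hvS⟩ := Finset.mem_sdiff.1 hv
      have hcl : c v = l := by
        by_contra hne
        exact hvS (h.inter_eq _ _ hne ▸ Finset.mem_inter.2 ⟨hc v, hvl⟩)
      subst hcl
      simp [splitBlock, Finset.restrict, hvS]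

/-- The bijection between the states with `i_S = j` and the index set of the tensors of format
`d_{C_0} × ⋯ × d_{C_{k-1}}`, where `C_l = K l \ S`. -/
def splitEquiv {V : Type*} [DecidableEq V] {G : SimpleGraph V} {k : ℕ}
    {K : Fin k → Finset V} {S : Finset V} (h : IsCliqueStar G K S) (d : V → ℕ)
    (j : SubState d S) : block d S j ≃ ∀ l, SubState d (K l \ S) :=
  Equiv.ofBijective _ (splitBlock_bijective h d j)

/-! ## The ideals -/

/-- The ideal of the `r`-th secant of the graphical model of `G`, in the polynomial ring in the
unknowns `p_i`, for `i` a joint state. -/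
def graphSecantIdeal {V : Type*} [Fintype V] (G : SimpleGraph V) (d : V → ℕ) (r : ℕ) :
    Ideal (MvPolynomial (State d) ℂ) :=
  secantIdeal r (graphModel G d)

/-- The ideal of the `r`-th secant of the independence model of format
`d_{C_0} × ⋯ × d_{C_{k-1}}`, written in the unknowns `p_i` with `i_S = j` (the state
`(x_0, …, x_{k-1})` of the independence model becomes the state `i` with `i_S = j` and
`i_{C_l} = x_l`) and extended to the polynomial ring in all the unknowns. -/
def blockSecantIdeal {V : Type*} [DecidableEq V] {G : SimpleGraph V} {k : ℕ}
    {K : Fin k → Finset V} {S : Finset V} (h : IsCliqueStar G K S) (d : V → ℕ) (r : ℕ)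
    (j : SubState d S) : Ideal (MvPolynomial (State d) ℂ) :=
  Ideal.map
    (rename (R := ℂ) fun x : (∀ l, SubState d (K l \ S)) => ((splitEquiv h d j).symm x : State d))
    (secantIdeal r (independenceModel fun l => SubState d (K l \ S)))

end CliqueStars

end

/-! Once `i_S = j` is fixed, the factor of the clique `K l` depends only on the `K l \ S` part, and
the parameters used for different `j` are independent. Hence the graphical model is a product, over
`j`, of Segre cones in disjoint blocks of coordinates (`graphModel_eq`). Secants respect such
products: in a cone the coefficients of an affine sum can be absorbed into the points, so the blocks
need not share them (`affineSums_setOf_forall_comp_mem`). Vanishing ideals turn the product into a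
sum of extended ideals (`vanishingIdeal_setOf_forall_comp_mem`), and closures are therefore also
taken blockwise. -/

namespace CliqueStars

/-! ### Vanishing ideals of products -/

section Product

variable {K : Type*} [Field K] {σ τ : Type*}

theorem map_rename_vanishingIdeal_le (e : τ → σ) (W : Set (τ → K)) :
    Ideal.map (rename (R := K) e) (vanishingIdeal K W) ≤
      vanishingIdeal K {p : σ → K | p ∘ e ∈ W} := by
  rw [Ideal.map_le_iff_le_comap]
  intro f hf p hp
  rw [aeval_rename]
  exact hf _ hp

theorem mem_zeroLocus_map_rename {e : τ → σ} {I : Ideal (MvPolynomial τ K)} {p : σ → K} :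
    p ∈ zeroLocus K (Ideal.map (rename (R := K) e) I) ↔ p ∘ e ∈ zeroLocus K I := by
  constructor
  · intro h f hf
    have := h _ (Ideal.mem_map_of_mem _ hf)
    rwa [aeval_rename] at this
  · intro h f hf
    have hle : Ideal.map (rename (R := K) e) I ≤ RingHom.ker (aeval (R := K) p) := by
      rw [Ideal.map_le_iff_le_comap]
      intro f hf
      rw [Ideal.mem_comap, RingHom.mem_ker, aeval_rename]
      exact h f hf
    exact hle hf

/-- Every polynomial is a sum of products of polynomials in the variables in the range of `e` and
polynomials in the other variables. -/
theorem exists_sum_rename_mul_rename (e : τ → σ) (f : MvPolynomial σ K) :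
    ∃ s : Finset (MvPolynomial τ K × MvPolynomial ↥(Set.range e)ᶜ K),
      f = ∑ i ∈ s, rename e i.1 * rename Subtype.val i.2 := by
  have hf : f ∈ (Algebra.TensorProduct.productMap (rename (R := K) e)
      (rename (R := K) (Subtype.val : ↥(Set.range e)ᶜ → σ))).range := by
    have htop : (⊤ : Subalgebra K (MvPolynomial σ K)) ≤
        (Algebra.TensorProduct.productMap (rename (R := K) e)
          (rename (R := K) (Subtype.val : ↥(Set.range e)ᶜ → σ))).range := by
      rw [← adjoin_range_X, Algebra.adjoin_le_iff, Algebra.TensorProduct.productMap_range]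
      rintro _ ⟨i, rfl⟩
      by_cases hi : i ∈ Set.range e
      · obtain ⟨x, rfl⟩ := hi
        exact (le_sup_left : _ ≤ (rename (R := K) e).range ⊔ _) ⟨X x, rename_X _ _⟩
      · exact (le_sup_right : (rename (R := K) (Subtype.val : ↥(Set.range e)ᶜ → σ)).range ≤ _)
          ⟨X ⟨i, hi⟩, rename_X _ _⟩
    exact htop trivial
  obtain ⟨t, rfl⟩ := hf
  obtain ⟨s, rfl⟩ := TensorProduct.exists_finset t
  exact ⟨s, by simp⟩

/-- Induction on the number of terms. A term whose `g a` vanishes on `Z` is dropped. Otherwise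
freezing the outer variables at a point of `Z` where `g a ≠ 0` gives a linear relation among the `c
i` modulo the ideal of `W`, which eliminates `c a`. The hypothesis `hZ` says that `Z` is a cylinder
along the block. -/
theorem sum_mem_sup_of_mem_vanishingIdeal_inter (e : τ → σ) (he : Function.Injective e)
    (W : Set (τ → K)) (Z : Set (σ → K))
    (hZ : ∀ p ∈ Z, ∀ q : σ → K, (∀ i ∉ Set.range e, q i = p i) → q ∈ Z)
    {ι : Type*} (s : Finset ι) (c : ι → MvPolynomial τ K)
    (g : ι → MvPolynomial ↥(Set.range e)ᶜ K)
    (h : ∑ i ∈ s, rename e (c i) * rename Subtype.val (g i) ∈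
      vanishingIdeal K (Z ∩ {p | p ∘ e ∈ W})) :
    ∑ i ∈ s, rename e (c i) * rename Subtype.val (g i) ∈
      vanishingIdeal K Z ⊔ Ideal.map (rename (R := K) e) (vanishingIdeal K W) := by
  classical
  induction s using Finset.induction_on generalizing g with
  | empty => simp
  | insert a s ha ih =>
    have hZle : vanishingIdeal K Z ≤ vanishingIdeal K (Z ∩ {p | p ∘ e ∈ W}) :=
      vanishingIdeal_anti_mono Set.inter_subset_left
    have hWle : Ideal.map (rename (R := K) e) (vanishingIdeal K W) ≤
        vanishingIdeal K (Z ∩ {p | p ∘ e ∈ W}) :=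
      (map_rename_vanishingIdeal_le e W).trans (vanishingIdeal_anti_mono Set.inter_subset_right)
    by_cases hga : rename Subtype.val (g a) ∈ vanishingIdeal K Z
    · have hmem := Ideal.mul_mem_left (vanishingIdeal K Z) (rename e (c a)) hga
      rw [Finset.sum_insert ha] at h ⊢
      exact Ideal.add_mem _ (Ideal.mem_sup_left hmem)
        (ih g ((Ideal.add_mem_iff_right _ (hZle hmem)).1 h))
    · obtain ⟨p, hp, hpa⟩ : ∃ p ∈ Z, aeval p (rename Subtype.val (g a)) ≠ 0 := by
        simpa [mem_vanishingIdeal_iff] using hga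
      set t : ι → K := fun i => aeval (p ∘ Subtype.val) (g i) with ht
      have hta : t a ≠ 0 := by rwa [aeval_rename] at hpa
      have hn : ∑ i ∈ insert a s, t i • c i ∈ vanishingIdeal K W := by
        intro w hw
        -- Overwriting the block of `p` by `w` keeps the point in `Z` and leaves the values of the
        -- `g i` unchanged.
        set q : σ → K := Function.extend e w p with hq
        have hqe : q ∘ e = w := funext fun x => he.extend_apply w p x
        have hqp : ∀ i ∉ Set.range e, q i = p i := fun i hi =>
          Function.extend_apply' w p i hi
        have h0 := h q ⟨hZ p hp q hqp, by rw [Set.mem_ofPred_eq, hqe]; exact hw⟩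
        rw [map_sum] at h0 ⊢
        rw [← h0]
        refine Finset.sum_congr rfl fun i _ => ?_
        have hqv : q ∘ (Subtype.val : ↥(Set.range e)ᶜ → σ) = p ∘ Subtype.val :=
          funext fun x => hqp x.1 x.2
        rw [map_mul, aeval_rename, aeval_rename, hqe, hqv, map_smul, smul_eq_mul, mul_comm]
      have hmem : rename e ((t a)⁻¹ • ∑ i ∈ insert a s, t i • c i) * rename Subtype.val (g a) ∈
          Ideal.map (rename (R := K) e) (vanishingIdeal K W) :=
        Ideal.mul_mem_right _ _ (Ideal.mem_map_of_mem _
          (Submodule.smul_of_tower_mem _ _ hn))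
      -- Substituting for `c a` changes the remaining `g i`, which is why the induction generalizes
      -- over `g`.
      have hsplit : ∑ i ∈ insert a s, rename e (c i) * rename Subtype.val (g i) =
          rename e ((t a)⁻¹ • ∑ i ∈ insert a s, t i • c i) * rename Subtype.val (g a) +
          ∑ i ∈ s, rename e (c i) *
            rename Subtype.val (g i - ((t a)⁻¹ * t i) • g a) := by
        rw [Finset.sum_insert ha, Finset.sum_insert ha, smul_add, smul_smul,
          inv_mul_cancel₀ hta, one_smul, map_add, add_mul, add_assoc, Finset.smul_sum, map_sum,
          Finset.sum_mul, ← Finset.sum_add_distrib]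
        congr 1
        refine Finset.sum_congr rfl fun i _ => ?_
        rw [smul_smul, map_smul, map_sub, map_smul, mul_sub, smul_mul_assoc, mul_smul_comm]
        ring
      rw [hsplit] at h ⊢
      exact Ideal.add_mem _ (Ideal.mem_sup_right hmem)
        (ih _ ((Ideal.add_mem_iff_right _ (hWle hmem)).1 h))

theorem vanishingIdeal_inter_eq_sup (e : τ → σ) (he : Function.Injective e)
    (W : Set (τ → K)) (Z : Set (σ → K))
    (hZ : ∀ p ∈ Z, ∀ q : σ → K, (∀ i ∉ Set.range e, q i = p i) → q ∈ Z) :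
    vanishingIdeal K (Z ∩ {p | p ∘ e ∈ W}) =
      vanishingIdeal K Z ⊔ Ideal.map (rename (R := K) e) (vanishingIdeal K W) := by
  apply le_antisymm
  · intro f hf
    obtain ⟨s, rfl⟩ := exists_sum_rename_mul_rename e f
    exact sum_mem_sup_of_mem_vanishingIdeal_inter e he W Z hZ s Prod.fst Prod.snd hf
  · exact sup_le (vanishingIdeal_anti_mono Set.inter_subset_left)
      ((map_rename_vanishingIdeal_le e W).trans (vanishingIdeal_anti_mono Set.inter_subset_right))

/-- The vanishing ideal of a product of sets in disjoint blocks of variables is the sum of the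
(extended) vanishing ideals of the factors. -/
theorem vanishingIdeal_setOf_forall_comp_mem [Infinite K] {ι : Type*} {τ : ι → Type*}
    (e : ∀ j, τ j → σ) (he : ∀ j, Function.Injective (e j))
    (hdisj : Pairwise fun j j' => Disjoint (Set.range (e j)) (Set.range (e j')))
    (W : ∀ j, Set (τ j → K)) (s : Finset ι) :
    vanishingIdeal K {p : σ → K | ∀ j ∈ s, p ∘ e j ∈ W j} =
      ∑ j ∈ s, Ideal.map (rename (R := K) (e j)) (vanishingIdeal K (W j)) := by
  classical
  induction s using Finset.induction_on with
  | empty =>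
    rw [Finset.sum_empty, Ideal.zero_eq_bot, eq_bot_iff]
    intro f hf
    refine MvPolynomial.funext fun x => ?_
    rw [map_zero]
    exact hf x (by simp)
  | insert a s ha ih =>
    have hset : {p : σ → K | ∀ j ∈ insert a s, p ∘ e j ∈ W j} =
        {p : σ → K | ∀ j ∈ s, p ∘ e j ∈ W j} ∩ {p | p ∘ e a ∈ W a} := by
      ext p
      simp [and_comm]
    rw [hset, vanishingIdeal_inter_eq_sup (e a) (he a), ih, Finset.sum_insert ha,
      Submodule.add_eq_sup, sup_comm]
    intro p hp q hqp j hj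
    have hqj : q ∘ e j = p ∘ e j := funext fun x => hqp _ fun hx =>
      Set.disjoint_left.1 (hdisj (ne_of_mem_of_not_mem hj ha)) ⟨x, rfl⟩ hx
    rw [hqj]
    exact hp j hj

end Product

/-! ### Closures and secants of products of cones -/

section Secant

variable {σ : Type*}

/-- The union of the affine spans of `r` points of `X`. -/
def affineSums (r : ℕ) (X : Set (σ → ℂ)) : Set (σ → ℂ) :=
  {p | ∃ (α : Fin r → ℂ) (v : Fin r → σ → ℂ),
      ∑ l, α l = 1 ∧ (∀ l, v l ∈ X) ∧ p = ∑ l, α l • v l}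

theorem secantIdeal_eq (r : ℕ) (X : Set (σ → ℂ)) :
    secantIdeal r X = vanishingIdeal ℂ (affineSums r (zariskiClosure X)) :=
  zeroLocus_vanishingIdeal_galoisConnection.u_l_u_eq_u (affineSums r (zariskiClosure X))

/-- Substituting `c * X i` for each variable sends polynomials vanishing on `X` to polynomials
vanishing on `X`. -/
theorem smul_mem_zariskiClosure {X : Set (σ → ℂ)} (hX : ∀ (c : ℂ), ∀ p ∈ X, c • p ∈ X) (c : ℂ)
    {p : σ → ℂ} (hp : p ∈ zariskiClosure X) : c • p ∈ zariskiClosure X := by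
  intro f hf
  have key : ∀ q : σ → ℂ, aeval q (bind₁ (fun i => C c * MvPolynomial.X i) f) = aeval (c • q) f := by
    intro q
    rw [aeval_bind₁]
    congr 2
    ext i
    simp
  rw [← key]
  refine hp _ fun q hq => ?_
  rw [key]
  exact hf _ (hX c q hq)

variable {ι : Type*} {τ : ι → Type*}

theorem zariskiClosure_setOf_forall_comp_mem [Fintype ι] (e : ∀ j, τ j → σ)
    (he : ∀ j, Function.Injective (e j))
    (hdisj : Pairwise fun j j' => Disjoint (Set.range (e j)) (Set.range (e j')))
    (W : ∀ j, Set (τ j → ℂ)) :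
    zariskiClosure {p : σ → ℂ | ∀ j, p ∘ e j ∈ W j} =
      {p | ∀ j, p ∘ e j ∈ zariskiClosure (W j)} := by
  have h := vanishingIdeal_setOf_forall_comp_mem e he hdisj W Finset.univ
  simp only [Finset.mem_univ, forall_true_left] at h
  ext p
  rw [zariskiClosure, h, Set.mem_ofPred_eq]
  constructor
  · intro hp j
    refine mem_zeroLocus_map_rename.1 (zeroLocus_anti_mono ?_ hp)
    rw [Ideal.sum_eq_sup]
    exact Finset.le_sup (f := fun j => Ideal.map (rename (R := ℂ) (e j)) (vanishingIdeal ℂ (W j)))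
      (Finset.mem_univ j)
  · intro hp f hf
    have hle : ∑ j, Ideal.map (rename (R := ℂ) (e j)) (vanishingIdeal ℂ (W j)) ≤
        vanishingIdeal ℂ {p} := by
      rw [Ideal.sum_eq_sup]
      refine Finset.sup_le fun j _ f hf => ?_
      rw [mem_vanishingIdeal_singleton_iff]
      exact mem_zeroLocus_map_rename.2 (hp j) f hf
    exact hle hf p rfl

/-- Affine sums of points of a product of cones can be formed in each factor separately. -/
theorem affineSums_setOf_forall_comp_mem (e : ∀ j, τ j → σ)
    (hbij : Function.Bijective fun x : Σ j, τ j => e x.1 x.2)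
    (W : ∀ j, Set (τ j → ℂ)) (hW : ∀ j, ∀ (c : ℂ), ∀ q ∈ W j, c • q ∈ W j) {r : ℕ} (hr : 1 ≤ r) :
    affineSums r {p : σ → ℂ | ∀ j, p ∘ e j ∈ W j} =
      {p | ∀ j, p ∘ e j ∈ affineSums r (W j)} := by
  ext p
  constructor
  · rintro ⟨α, v, hα, hv, rfl⟩ j
    refine ⟨α, fun l => v l ∘ e j, hα, fun l => hv l j, ?_⟩
    ext x
    simp
  · intro hp
    choose α v hα hv hpv using hp
    have hr0 : (r : ℂ) ≠ 0 := by exact_mod_cast (by omega : r ≠ 0)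
    set E := Equiv.ofBijective _ hbij with hE
    have hEe : ∀ j (x : τ j), E.symm (e j x) = ⟨j, x⟩ := fun j x =>
      E.symm_apply_eq.2 rfl
    -- Each block comes with its own weights, but one common choice is required: take all weights `1
    -- / r` and rescale the `l`-th point in block `j` by `r * α j l`.
    refine ⟨fun _ => (r : ℂ)⁻¹,
      fun l i => (r : ℂ) * (α (E.symm i).1 l * v (E.symm i).1 l (E.symm i).2), ?_, ?_, ?_⟩
    · simp [hr0]
    · intro l j
      have : (fun i => (r : ℂ) * (α (E.symm i).1 l * v (E.symm i).1 l (E.symm i).2)) ∘ e j =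
          ((r : ℂ) * α j l) • v j l := by
        ext x
        simp only [Function.comp_apply, Pi.smul_apply, smul_eq_mul]
        rw [hEe, mul_assoc]
      rw [this]
      exact hW j _ _ (hv j l)
    · ext i
      obtain ⟨⟨j, x⟩, rfl⟩ := hbij.2 i
      have := congrFun (hpv j) x
      simp only [Function.comp_apply, Finset.sum_apply, Pi.smul_apply, smul_eq_mul] at this ⊢
      rw [this]
      refine Finset.sum_congr rfl fun l _ => ?_
      rw [hEe, inv_mul_cancel_left₀ hr0]

/-- The secant ideal of a product of cones is the sum of the secant ideals of the factors. -/
theorem secantIdeal_setOf_forall_comp_mem [Fintype ι] (e : ∀ j, τ j → σ)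
    (hbij : Function.Bijective fun x : Σ j, τ j => e x.1 x.2)
    (W : ∀ j, Set (τ j → ℂ)) (hW : ∀ j, ∀ (c : ℂ), ∀ q ∈ W j, c • q ∈ W j) {r : ℕ} (hr : 1 ≤ r) :
    secantIdeal r {p : σ → ℂ | ∀ j, p ∘ e j ∈ W j} =
      ∑ j, Ideal.map (rename (R := ℂ) (e j)) (secantIdeal r (W j)) := by
  have he : ∀ j, Function.Injective (e j) := fun j x y hxy =>
    sigma_mk_injective (hbij.1 (a₁ := ⟨j, x⟩) (a₂ := ⟨j, y⟩) hxy)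
  have hdisj : Pairwise fun j j' => Disjoint (Set.range (e j)) (Set.range (e j')) := by
    intro j j' hne
    rw [Set.disjoint_left]
    rintro _ ⟨x, rfl⟩ ⟨y, hy⟩
    exact hne (congrArg Sigma.fst (hbij.1 (a₁ := ⟨j', y⟩) (a₂ := ⟨j, x⟩) hy)).symm
  simp only [secantIdeal_eq]
  rw [zariskiClosure_setOf_forall_comp_mem e he hdisj,
    affineSums_setOf_forall_comp_mem e hbij _
      (fun j c q hq => smul_mem_zariskiClosure (hW j) c hq) hr]
  have h := vanishingIdeal_setOf_forall_comp_mem e he hdisj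
    (fun j => affineSums r (zariskiClosure (W j))) Finset.univ
  simpa only [Finset.mem_univ, forall_true_left] using h

end Secant

theorem smul_mem_independenceModel {k : ℕ} (hk : 0 < k) (R : Fin k → Type*) (c : ℂ) :
    ∀ q ∈ independenceModel R, c • q ∈ independenceModel R := by
  rintro _ ⟨θ, rfl⟩
  -- The scalar goes into a single factor; for `k = 0` the model would be one point and not a cone.
  refine ⟨fun l x => (if l = ⟨0, hk⟩ then c else 1) * θ l x, ?_⟩
  ext x
  simp only [Finset.prod_mul_distrib, Finset.prod_ite_eq', Finset.mem_univ, if_true,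
    Pi.smul_apply, smul_eq_mul]

/-! ### Clique stars and their graphical models -/

section Graph

variable {V : Type*} [DecidableEq V] {G : SimpleGraph V} {k : ℕ}
  {K : Fin k → Finset V} {S : Finset V}

theorem IsCliqueStar.center_subset (h : IsCliqueStar G K S) (l : Fin k) : S ⊆ K l := by
  by_cases hm : ∃ m, l ≠ m
  · obtain ⟨m, hm⟩ := hm
    rw [← h.inter_eq l m hm]
    exact Finset.inter_subset_left
  · push Not at hm
    intro v _
    obtain ⟨m, hv⟩ := h.cover_vertex v
    rwa [hm m]

/-- A vertex of `C` outside `S` lies in only one `K l`, so the edges joining it to the rest of `C`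
are all covered by that `K l`. -/
theorem IsCliqueStar.exists_eq_of_isMaxClique (h : IsCliqueStar G K S) {C : Finset V}
    (hC : IsMaxClique G C) : ∃ l, K l = C := by
  suffices ∃ l, C ⊆ K l by
    obtain ⟨l, hl⟩ := this
    exact ⟨l, (hC.2 (h.isMaxClique l).1 hl).antisymm hl⟩
  by_cases hCS : C ⊆ S
  · exact ⟨⟨0, h.pos⟩, hCS.trans (h.center_subset _)⟩
  · obtain ⟨v, hvC, hvS⟩ := Finset.not_subset.1 hCS
    obtain ⟨l, hl⟩ := h.cover_vertex v
    refine ⟨l, fun w hw => ?_⟩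
    by_cases hvw : v = w
    · rwa [← hvw]
    · obtain ⟨m, hvm, hwm⟩ := h.cover_edge v w (hC.1 hvC hw hvw)
      have hlm : l = m := by
        by_contra hne
        exact hvS (h.inter_eq l m hne ▸ Finset.mem_inter.2 ⟨hl, hvm⟩)
      rwa [hlm]

/-- The maximal cliques of a clique star are the `K l`. -/
noncomputable def cliqueEquiv (h : IsCliqueStar G K S) : Fin k ≃ MaxClique G :=
  Equiv.ofBijective (fun l => ⟨K l, h.isMaxClique l⟩)
    ⟨fun _ _ hlm => h.injective (congrArg Subtype.val hlm),
      fun C => (h.exists_eq_of_isMaxClique C.2).imp fun _ hl => Subtype.ext hl⟩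

/-- The state with `S`-part `j` and with part `x l` on `K l \ S`. -/
noncomputable def blockState (h : IsCliqueStar G K S) (d : V → ℕ) (j : SubState d S)
    (x : ∀ l, SubState d (K l \ S)) : State d :=
  (splitEquiv h d j).symm x

theorem restrict_blockState (h : IsCliqueStar G K S) (d : V → ℕ) (j : SubState d S)
    (x : ∀ l, SubState d (K l \ S)) : S.restrict (blockState h d j x) = j :=
  ((splitEquiv h d j).symm x).2

theorem restrict_sdiff_blockState (h : IsCliqueStar G K S) (d : V → ℕ) (j : SubState d S)
    (x : ∀ l, SubState d (K l \ S)) (l : Fin k) :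
    (K l \ S).restrict (blockState h d j x) = x l :=
  congrFun ((splitEquiv h d j).apply_symm_apply x) l

theorem blockState_bijective (h : IsCliqueStar G K S) (d : V → ℕ) :
    Function.Bijective
      fun x : Σ _ : SubState d S, ∀ l, SubState d (K l \ S) => blockState h d x.1 x.2 := by
  constructor
  · rintro ⟨j, x⟩ ⟨j', x'⟩ heq
    have hj : j = j' := by
      rw [← restrict_blockState h d j x, ← restrict_blockState h d j' x']
      exact congrArg _ heq
    subst hj
    have hx : x = x' := funext fun l => by
      rw [← restrict_sdiff_blockState h d j x l, ← restrict_sdiff_blockState h d j x' l]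
      exact congrArg _ heq
    rw [hx]
  · intro i
    refine ⟨⟨S.restrict i, splitEquiv h d _ ⟨i, rfl⟩⟩, ?_⟩
    exact congrArg Subtype.val ((splitEquiv h d (S.restrict i)).symm_apply_apply ⟨i, rfl⟩)

/-- The graphical model of a clique star is the product, over the states `j` of the centre, of
independence models. -/
theorem graphModel_eq [Fintype V] (h : IsCliqueStar G K S) (d : V → ℕ) :
    graphModel G d = {p | ∀ j, p ∘ blockState h d j ∈
      independenceModel fun l => SubState d (K l \ S)} := by
  ext p
  constructor
  · rintro ⟨θ, rfl⟩ j
    -- The parameters of block `j` are those of the graph with the `S`-part frozen at `j`.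
    refine ⟨fun l y => θ (cliqueEquiv h l) fun v : K l =>
      if hv : v.1 ∈ S then j ⟨v, hv⟩ else y ⟨v, Finset.mem_sdiff.2 ⟨v.2, hv⟩⟩, ?_⟩
    ext x
    refine Fintype.prod_equiv (cliqueEquiv h) _ _ fun l => ?_
    refine congrArg (θ (cliqueEquiv h l)) ?_
    funext v
    change _ = blockState h d j x v
    split_ifs with hv
    · exact (congrFun (restrict_blockState h d j x) ⟨v, hv⟩).symm
    · exact (congrFun (restrict_sdiff_blockState h d j x l)
        ⟨v, Finset.mem_sdiff.2 ⟨v.2, hv⟩⟩).symm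
  · intro hp
    choose θ hθ using hp
    have hK : ∀ C : MaxClique G, K ((cliqueEquiv h).symm C) = C.1 := fun C =>
      congrArg Subtype.val ((cliqueEquiv h).apply_symm_apply C)
    -- Since `S` lies in every maximal clique, each clique parameter can read off `j` from its own
    -- argument and use the parameters of that block.
    refine ⟨fun C z => θ (fun v => z ⟨v, hK C ▸ h.center_subset _ v.2⟩) ((cliqueEquiv h).symm C)
      fun v => z ⟨v, hK C ▸ (Finset.mem_sdiff.1 v.2).1⟩, ?_⟩
    ext i
    obtain ⟨⟨j, x⟩, rfl⟩ := (blockState_bijective h d).2 i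
    refine Eq.trans ?_ (congrFun (hθ j) x)
    refine Fintype.prod_equiv (cliqueEquiv h).symm _ _ fun C => ?_
    exact congrArg₂ (fun a b => θ a ((cliqueEquiv h).symm C) b)
      (restrict_blockState h d j x) (restrict_sdiff_blockState h d j x _)

end Graph

end CliqueStars

theorem theorem3p5 {V : Type*} [Fintype V] [DecidableEq V] (G : SimpleGraph V)
    (d : V → ℕ) (hd : ∀ v, 0 < d v)
    {k : ℕ} (K : Fin k → Finset V) (S : Finset V) (h : CliqueStars.IsCliqueStar G K S)
    (r : ℕ) (hr : 1 ≤ r) :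
    CliqueStars.graphSecantIdeal G d r
        = ∑ j : CliqueStars.SubState d S, CliqueStars.blockSecantIdeal h d r j ∧
      (∀ j : CliqueStars.SubState d S, ∃ F : Set (MvPolynomial (CliqueStars.State d) ℂ),
        F ⊆ MvPolynomial.supported ℂ (CliqueStars.block d S j) ∧
          CliqueStars.blockSecantIdeal h d r j = Ideal.span F) ∧
      Pairwise fun j j' : CliqueStars.SubState d S =>
        Disjoint (CliqueStars.block d S j) (CliqueStars.block d S j') := by
  -- `Ideal.map` is by definition the span of the image, so `rfl` fixes the generating set as the
  -- renamed secant ideal.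
  refine ⟨?_, fun j => ⟨_, ?_, rfl⟩, fun j j' hne => ?_⟩
  · rw [CliqueStars.graphSecantIdeal, CliqueStars.graphModel_eq h d]
    exact CliqueStars.secantIdeal_setOf_forall_comp_mem (CliqueStars.blockState h d)
      (CliqueStars.blockState_bijective h d) _
      (fun _ => CliqueStars.smul_mem_independenceModel h.pos _) hr
  · rintro _ ⟨f, -, rfl⟩
    rw [MvPolynomial.supported_eq_range_rename]
    refine ⟨MvPolynomial.rename (CliqueStars.splitEquiv h d j).symm f, ?_⟩
    exact MvPolynomial.rename_rename _ _ f
  · exact Set.disjoint_left.2 fun i hi hi' => hne (hi.symm.trans hi')
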